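/- **Theorem (Penrose).** Let $G$ be a finite cubic graph (multiple edges and loops allowed, every node of degree $3$ with loops counted twice) embedded in the oriented plane: nodes are distinct points, each edge is an arc joining its end nodes (a simple closed curve through its node, if it is a loop), and edges do not meet each other or pass through nodes except at their ends. Let $\epsilon_{ijk}$, for $i,j,k$ in the set of colors $\{r,b,p\}$, be $+1$ if $(ijk)$ is one of $(rbp),(bpr),(prb)$, be $-1$ if $(ijk)$ is one of $(rpb),(pbr),(brp)$, and be $0$ otherwise, and put $P_{ijk}=\sqrt{-1}\,\epsilon_{ijk}$. For an arbitrary assignment $c$ of colors to the edges of $G$ and a node $v$, let $P_v(c)=P_{ijk}$, where $i,j,k$ are the colors of the three edge-ends at $v$, listed in clockwise order around $v$ (the order in which the points where they first meet a sufficiently small circle around $v$ follow one another on it; cyclic rotations of the list do not change $P_{ijk}$). Define the Penrose bracket $$[G]=\sum_{c:E(G)\to\{r,b,p\}}\ \prod_{v\in V(G)}P_v(c).$$ Then $[G]$ is equal to the number of proper edge 3-colorings of $G$, that is, of maps $c:E(G)\to\{r,b,p\}$ such that every node sees all three colors at its edges. -/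

import Mathlib

open Filter Topology
open scoped Graph

/-- The three colors: red, blue, purple. -/
inductive EdgeColor where
  | r
  | b
  | p
  deriving DecidableEq

namespace EdgeColor

instance : Fintype EdgeColor where
  elems := {r, b, p}
  complete x := by cases x <;> decide

/-- The epsilon tensor: `1` on `(rbp), (bpr), (prb)`, `-1` on `(rpb), (pbr), (brp)`, and `0` on
triples that are not permutations of the colors. -/
def eps : EdgeColor → EdgeColor → EdgeColor → ℤ
  | r, b, p => 1
  | b, p, r => 1
  | p, r, b => 1
  | r, p, b => -1
  | p, b, r => -1
  | b, r, p => -1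
  | _, _, _ => 0

/-- The tensor `P i j k = √-1 * ε i j k`. -/
noncomputable def penroseTensor (i j k : EdgeColor) : ℂ :=
  Complex.I * (eps i j k : ℂ)

end EdgeColor

namespace Graph

variable {α β : Type*}

/-- A (multi)graph is cubic if every node has degree `3`, loops counted twice: a node belongs
either to three edges, none of them a loop at it, or to one loop and one other edge. -/
def IsCubic (G : Graph α β) : Prop :=
  ∀ v ∈ V(G), {e | G.IsNonloopAt e v}.ncard + 2 * {e | G.IsLoopAt e v}.ncard = 3

/-- A proper 3-edge-coloring: every node sees all three colors at its edges. -/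
def IsProperColoring (G : Graph α β) (c : E(G) → EdgeColor) : Prop :=
  ∀ v ∈ V(G), ∀ k : EdgeColor, ∃ e : E(G), G.Inc e v ∧ c e = k

/-- An embedding of the multigraph `G` in the plane `ℂ`: distinct nodes are distinct points, every
edge is an arc, parametrized by `[0, 1]`, joining its end nodes (a closed curve for a loop), and
arcs neither pass through nodes nor meet themselves or each other, except at their ends. -/
structure PlaneEmbedding (G : Graph α β) where
  /-- the position of a node -/
  point : V(G) → ℂ
  /-- the node at which the parametrization of an edge starts -/
  tail : E(G) → V(G)
  /-- the node at which the parametrization of an edge stops -/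
  head : E(G) → V(G)
  /-- the arc that represents an edge; only its restriction to `[0, 1]` matters -/
  arc : E(G) → ℝ → ℂ
  isLink : ∀ e : E(G), G.IsLink e (tail e) (head e)
  point_injective : Function.Injective point
  arc_continuousOn : ∀ e, ContinuousOn (arc e) (Set.Icc 0 1)
  arc_zero : ∀ e, arc e 0 = point (tail e)
  arc_one : ∀ e, arc e 1 = point (head e)
  arc_ne_point : ∀ e, ∀ t ∈ Set.Ioo (0 : ℝ) 1, ∀ v, arc e t ≠ point v
  arc_injective : ∀ e f, ∀ s ∈ Set.Ioo (0 : ℝ) 1, ∀ t ∈ Set.Ioo (0 : ℝ) 1,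
    arc e s = arc f t → e = f ∧ s = t

/-- A dart (half-edge): an edge together with one of its two ends, `false` for the tail and `true`
for the head. A loop has two darts at its node. -/
abbrev PlaneDart (G : Graph α β) : Type _ := E(G) × Bool

namespace PlaneEmbedding

variable {G : Graph α β} (D : G.PlaneEmbedding)

/-- The node at which a dart is based. -/
def base (d : G.PlaneDart) : V(G) := if d.2 then D.head d.1 else D.tail d.1

/-- The arc of the edge of a dart, run through from the base of the dart. -/
def dartArc (d : G.PlaneDart) (t : ℝ) : ℂ := if d.2 then D.arc d.1 (1 - t) else D.arc d.1 t

/-- The first point at which the arc of a dart meets the circle of radius `r` around its base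
(used for small `r > 0`, where such a point exists). -/
noncomputable def exitPoint (d : G.PlaneDart) (r : ℝ) : ℂ :=
  D.dartArc d (sInf {t ∈ Set.Icc (0 : ℝ) 1 | dist (D.dartArc d t) (D.point (D.base d)) = r})

/-- `d 0, d 1, d 2` are the darts at the node `v`, listed once each and in clockwise order: on all
sufficiently small circles around `v` their exit points follow one another clockwise.
Three points of a circle are in clockwise order if and only if the triangle that they form is
negatively oriented, that is, `Im (conj (z₁ - z₀) * (z₂ - z₀)) < 0`. -/
def IsClockwiseListing (v : V(G)) (d : Fin 3 → G.PlaneDart) : Prop :=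
  Function.Injective d ∧ Set.range d = {x | D.base x = v} ∧
    ∀ᶠ r in 𝓝[>] (0 : ℝ),
      ((starRingEnd ℂ) (D.exitPoint (d 1) r - D.exitPoint (d 0) r) *
        (D.exitPoint (d 2) r - D.exitPoint (d 0) r)).im < 0

open Classical in
/-- The value at the node `v` of the tensor `P i j k`, where `i, j, k` are the colors of the edges
at `v` in clockwise order. A clockwise listing of the darts at a node of a cubic graph always
exists and is unique up to cyclic rotation, which does not change the value of the tensor. -/
noncomputable def nodeValue (c : E(G) → EdgeColor) (v : V(G)) : ℂ :=
  if h : ∃ d, D.IsClockwiseListing v d then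
    EdgeColor.penroseTensor (c (h.choose 0).1) (c (h.choose 1).1) (c (h.choose 2).1)
  else 0

open Classical in
/-- The Penrose bracket `[G]` of an embedded cubic graph: the sum, over all assignments of colors
to the edges, of the product over the nodes of the values of the tensor `P`. -/
noncomputable def penroseBracket [Fintype V(G)] [Fintype E(G)] : ℂ :=
  ∑ c : E(G) → EdgeColor, ∏ v : V(G), D.nodeValue c v

end PlaneEmbedding

end Graph

/-! A coloring that is not proper contributes 0: some node misses a color, and there the tensor
vanishes. It remains to see that a proper coloring contributes 1. Each node then has one red, one
blue and one purple dart, and its value is √-1 times a sign that records their cyclic order.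

These signs are multiplied globally by means of square roots of differences of points. For each
ordered pair of edges `e`, `f` choose a continuous logarithm of `arc f t - arc e s`
(`nonempty_arcLog`). Replacing `e` by another edge at the same node changes the square root of the
difference from that node by a sign that is constant along `f` (`leftSign_eq`); `rightSign_eq` is
the same for the other argument. For nodes `v ≠ w`, the four signs that compare red with purple at
`v` and blue with purple at `w` multiply to 1 (`prod_pair_eq_one`). In the product over all such
pairs, a sign attached to an edge occurs at both ends of the edge and cancels, except where one end
is the excluded node. What survives is the product of the `nodeSign`s, which is therefore 1
(`prod_sign`).

Close to a node, the differences of the exit points tie `nodeSign` to the cyclic order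
(`orientation_exit`), up to the direction of the purple dart. That direction enters through the half
turn between `arc e t - arc e s` and its negative. So a node value is √-1 · `dartSign` · `nodeSign`,
and the first two factors multiply to 1 over the two ends of each purple edge
(`prod_I_mul_dartSign`). -/

section Analysis

open Complex Set

/-! ### Continuous logarithms and first exits from a disc. -/

/-- A nonvanishing continuous function on a star-shaped set has a continuous logarithm. -/
theorem StarConvex.exists_continuousOn_exp_eq {E : Type*} [AddCommGroup E] [Module ℝ E]
    [TopologicalSpace E] [IsTopologicalAddGroup E] [ContinuousSMul ℝ E] {S : Set E} {p : E}
    (hS : StarConvex ℝ p S) {f : E → ℂ} (hf : ContinuousOn f S) (h0 : ∀ x ∈ S, f x ≠ 0) :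
    ∃ g : E → ℂ, ContinuousOn g S ∧ ∀ x ∈ S, exp (g x) = f x := by
  classical
  rcases S.eq_empty_or_nonempty with rfl | hne
  · exact ⟨0, by simp, by simp⟩
  have hp : p ∈ S := hS.mem hne
  have hmem : ∀ q : unitInterval × S, p + (q.1 : ℝ) • ((q.2 : E) - p) ∈ S := fun q ↦
    hS.add_smul_sub_mem q.2.2 q.1.2.1 q.1.2.2
  -- The straight-line contraction of `S` to `p` is constant at time 0, where `log (f p)` lifts it;
  -- the time-1 slice of the lifted homotopy is the logarithm.
  let H : C(unitInterval × S, {z : ℂ // z ≠ 0}) :=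
    ⟨fun q ↦ ⟨f (p + (q.1 : ℝ) • ((q.2 : E) - p)), h0 _ (hmem q)⟩, by
      refine Continuous.subtype_mk ?_ _
      exact hf.comp_continuous (by fun_prop) hmem⟩
  let c : C(S, ℂ) := .const S (log (f p))
  have H0 : ∀ a, H (0, a) = ⟨exp (c a), exp_ne_zero _⟩ := fun a ↦ by
    simp [H, c, exp_log (h0 p hp)]
  let F := isCoveringMap_exp.liftHomotopy H c H0
  have hF : ∀ a : S, exp (F (1, a)) = f a := fun a ↦ by
    have : exp (F (1, a)) = (H (1, a) : ℂ) := congrArg Subtype.val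
      (congr_fun (isCoveringMap_exp.liftHomotopy_lifts H c H0) (1, a))
    exact this.trans (by simp [H])
  refine ⟨fun x ↦ if hx : x ∈ S then F (1, ⟨x, hx⟩) else 0, ?_, fun x hx ↦ ?_⟩
  · rw [continuousOn_iff_continuous_domRestrict]
    have : Continuous fun a : S ↦ F (1, a) := by fun_prop
    refine this.congr fun a ↦ ?_
    simp
  · simp [hx, hF]

/-- Two continuous logarithms of the same function on a connected set differ by a constant; in
particular, the sign relating the corresponding square roots is constant. -/
theorem IsPreconnected.exp_half_sub_eq {S : Set ℝ} (hS : IsPreconnected S) {g h : ℝ → ℂ}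
    (hg : ContinuousOn g S) (hh : ContinuousOn h S) (hexp : ∀ t ∈ S, exp (g t) = exp (h t))
    {s t : ℝ} (hs : s ∈ S) (ht : t ∈ S) :
    exp ((g s - h s) / 2) = exp ((g t - h t) / 2) := by
  have hc : ContinuousOn (fun t ↦ exp ((g t - h t) / 2)) S := by fun_prop
  have hsq : EqOn ((fun t ↦ exp ((g t - h t) / 2)) ^ 2) 1 S := fun t ht ↦ by
    simp only [Pi.pow_apply, Pi.one_apply, ← exp_nat_mul]
    rw [show ((2 : ℕ) : ℂ) * ((g t - h t) / 2) = g t - h t by push_cast; ring, exp_sub, hexp t ht,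
      div_self (exp_ne_zero _)]
  rcases hS.eq_one_or_eq_neg_one_of_sq_eq hc hsq with h' | h' <;>
    exact (h' hs).trans (h' ht).symm

theorem exp_half_sub_sq {x y : ℂ} (h : exp x = exp y) : exp ((x - y) / 2) ^ 2 = 1 := by
  rw [← exp_nat_mul, show ((2 : ℕ) : ℂ) * ((x - y) / 2) = x - y by push_cast; ring, exp_sub, h,
    div_self (exp_ne_zero _)]

/-- A continuous logarithm that starts at `0` and whose exponential stays in the right half plane
is the principal logarithm. -/
theorem eq_log_exp_of_re_exp_pos {T : ℝ} (hT : 0 ≤ T) {g : ℝ → ℂ}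
    (hg : ContinuousOn g (Icc 0 T)) (h0 : g 0 = 0) (hre : ∀ t ∈ Icc 0 T, 0 < (exp (g t)).re) :
    g T = log (exp (g T)) := by
  have hcos : ∀ t ∈ Icc 0 T, 0 < Real.cos (g t).im := fun t ht ↦ by
    have := hre t ht
    rw [exp_re] at this
    exact pos_of_mul_pos_right this (Real.exp_pos _).le
  have him : ContinuousOn (fun t ↦ (g t).im) (Icc 0 T) := continuous_im.comp_continuousOn hg
  have h0' : (g 0).im = 0 := by rw [h0]; rfl
  have hpi := Real.pi_pos
  have hlt : (g T).im < Real.pi / 2 := by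
    -- Reaching the imaginary part π/2 would make the cosine vanish on the way.
    by_contra! hge
    obtain ⟨t, ht, hteq⟩ := intermediate_value_Icc hT him (show Real.pi / 2 ∈ Icc _ _ from
      ⟨by simp only [h0']; positivity, hge⟩)
    have := hcos t ht
    simp only at hteq
    rw [hteq, Real.cos_pi_div_two] at this
    exact lt_irrefl _ this
  have hgt : -(Real.pi / 2) < (g T).im := by
    by_contra! hge
    obtain ⟨t, ht, hteq⟩ := intermediate_value_Icc' hT him (show -(Real.pi / 2) ∈ Icc _ _ from
      ⟨hge, by simp only [h0']; linarith⟩)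
    have := hcos t ht
    simp only at hteq
    rw [hteq, Real.cos_neg, Real.cos_pi_div_two] at this
    exact lt_irrefl _ this
  exact (log_exp (by linarith) (by linarith)).symm

/-- For a point `u ≠ 1` of the unit circle, half the difference of the principal logarithms of
`1 - u` and `1 - u⁻¹` has exponential `(1 - u) / |1 - u|`. -/
theorem norm_mul_exp_half_log_sub_log {u : ℂ} (hu : ‖u‖ = 1) (hre : 0 < (1 - u).re) :
    ‖1 - u‖ * exp ((log (1 - u) - log (1 - u⁻¹)) / 2) = 1 - u := by
  have hinv : u⁻¹ = (starRingEnd ℂ) u := by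
    rw [inv_def, normSq_eq_norm_sq, hu]; simp
  have hconj : (1 : ℂ) - u⁻¹ = (starRingEnd ℂ) (1 - u) := by rw [hinv]; simp
  have harg : (1 - u).arg ≠ Real.pi := by
    intro h
    have := (abs_arg_lt_pi_div_two_iff.2 (Or.inl hre))
    rw [h, abs_of_pos Real.pi_pos] at this
    linarith [Real.pi_pos]
  rw [hconj, log_conj _ harg]
  have : (log (1 - u) - (starRingEnd ℂ) (log (1 - u))) / 2 = (1 - u).arg * I := by
    apply Complex.ext <;> simp [log_im, log_re]
  rw [this, norm_mul_exp_arg_mul_I]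

/-- A path that starts at `p` and ends outside the open disc of radius `r` around `p` meets the
circle of radius `r` for the first time at some positive parameter. -/
theorem exists_first_exit {γ : ℝ → ℂ} (hγ : ContinuousOn γ (Icc 0 1)) {p : ℂ} (h0 : γ 0 = p)
    {r : ℝ} (hr : 0 < r) (h1 : r ≤ dist (γ 1) p) :
    let τ := sInf {t ∈ Icc (0 : ℝ) 1 | dist (γ t) p = r}
    0 < τ ∧ τ ≤ 1 ∧ dist (γ τ) p = r ∧ ∀ t ∈ Icc 0 τ, dist (γ t) p ≤ r := by
  intro τ
  have hd : ContinuousOn (fun t ↦ dist (γ t) p) (Icc 0 1) := 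
    (continuous_id.dist continuous_const).comp_continuousOn hγ
  have hd0 : dist (γ 0) p = 0 := by simp [h0]
  set A := {t ∈ Icc (0 : ℝ) 1 | dist (γ t) p = r} with hA
  have hne : A.Nonempty := by
    obtain ⟨t, ht, hteq⟩ := intermediate_value_Icc zero_le_one hd
      (show r ∈ Icc _ _ from ⟨by simp only [hd0]; exact hr.le, h1⟩)
    exact ⟨t, ht, hteq⟩
  have hcl : IsClosed A := by
    have := hd.preimage_isClosed_of_isClosed isClosed_Icc (isClosed_singleton (x := r))
    exact this
  have hbdd : BddBelow A := ⟨0, fun t ht ↦ ht.1.1⟩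
  have hτ : τ ∈ A := hcl.csInf_mem hne hbdd
  have hτ0 : 0 < τ := by
    refine lt_of_le_of_ne hτ.1.1 fun h ↦ ?_
    have := hτ.2
    rw [← h, hd0] at this
    exact hr.ne this
  refine ⟨hτ0, hτ.1.2, hτ.2, fun t ht ↦ ?_⟩
  by_contra! hlt
  obtain ⟨s, hs, hseq⟩ := intermediate_value_Icc ht.1
    (hd.mono (Icc_subset_Icc le_rfl (ht.2.trans hτ.1.2)))
    (show r ∈ Icc _ _ from ⟨by simp only [hd0]; exact hr.le, hlt.le⟩)
  have hsA : s ∈ A := ⟨⟨hs.1, hs.2.trans (ht.2.trans hτ.1.2)⟩, hseq⟩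
  have hle : τ ≤ s := csInf_le hbdd hsA
  have : s = t := le_antisymm hs.2 (ht.2.trans hle)
  rw [this] at hseq
  exact hlt.ne' hseq

end Analysis

/-! ### Logarithms of the differences between points of two arcs. -/

namespace Graph.PlaneEmbedding

open Complex Set

variable {α β : Type*} {G : Graph α β} (D : G.PlaneEmbedding)

theorem arc_ends_eq_point (e : E(G)) {t : ℝ} (ht : t = 0 ∨ t = 1) : ∃ v, D.arc e t = D.point v := by
  rcases ht with rfl | rfl
  exacts [⟨_, D.arc_zero e⟩, ⟨_, D.arc_one e⟩]

theorem eq_ends_or_mem_Ioo {t : ℝ} (ht : t ∈ Icc (0 : ℝ) 1) :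
    (t = 0 ∨ t = 1) ∨ t ∈ Ioo (0 : ℝ) 1 := by
  rcases ht.1.eq_or_lt with h | h
  · exact .inl (.inl h.symm)
  rcases ht.2.eq_or_lt with h' | h'
  exacts [.inl (.inr h'), .inr ⟨h, h'⟩]

theorem arc_eq_arc {e f : E(G)} {s t : ℝ} (hs : s ∈ Icc (0 : ℝ) 1) (ht : t ∈ Icc (0 : ℝ) 1)
    (h : D.arc e s = D.arc f t) :
    (e = f ∧ s = t) ∨ ((s = 0 ∨ s = 1) ∧ (t = 0 ∨ t = 1)) := by
  rcases eq_ends_or_mem_Ioo hs with hs' | hs' <;> rcases eq_ends_or_mem_Ioo ht with ht' | ht'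
  · exact .inr ⟨hs', ht'⟩
  · obtain ⟨v, hv⟩ := D.arc_ends_eq_point e hs'
    exact absurd (h.symm.trans hv) (D.arc_ne_point f t ht' v)
  · obtain ⟨v, hv⟩ := D.arc_ends_eq_point f ht'
    exact absurd (h.trans hv) (D.arc_ne_point e s hs' v)
  · exact .inl (D.arc_injective e f s hs' t ht' h)

theorem arc_injOn {e : E(G)} (he : D.tail e ≠ D.head e) : InjOn (D.arc e) (Icc 0 1) := by
  intro s hs t ht h
  have hne : D.arc e 0 ≠ D.arc e 1 := by
    rw [D.arc_zero, D.arc_one]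
    exact D.point_injective.ne he
  rcases D.arc_eq_arc hs ht h with h' | ⟨rfl | rfl, rfl | rfl⟩
  exacts [h'.2, rfl, absurd h hne, absurd h.symm hne, rfl]

/-- The pairs of parameters at which the arcs of two edges take different values. -/
def offDiag (e f : E(G)) : Set (ℝ × ℝ) :=
  {p | p.1 ∈ Icc (0 : ℝ) 1 ∧ p.2 ∈ Icc (0 : ℝ) 1 ∧ D.arc e p.1 ≠ D.arc f p.2}

/-- Continuous logarithms of the differences `arc f t - arc e s`. -/
structure ArcLog where
  /-- the logarithm of `arc f t - arc e s` at `(s, t)` -/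
  log : E(G) → E(G) → ℝ × ℝ → ℂ
  continuousOn : ∀ e f, ContinuousOn (log e f) (D.offDiag e f)
  exp_log : ∀ e f, ∀ p ∈ D.offDiag e f, exp (log e f p) = D.arc f p.2 - D.arc e p.1
  log_swap : ∀ e, ∀ s t : ℝ, t < s → log e e (s, t) = log e e (t, s) + Real.pi * I

variable {D}

theorem continuousOn_arc_sub_arc (e f : E(G)) :
    ContinuousOn (fun p : ℝ × ℝ ↦ D.arc f p.2 - D.arc e p.1) (Icc 0 1 ×ˢ Icc 0 1) :=
  ((D.arc_continuousOn f).comp continuousOn_snd fun _ h ↦ h.2).sub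
    ((D.arc_continuousOn e).comp continuousOn_fst fun _ h ↦ h.1)

/-- Arcs of distinct edges meet only at ends, so `offDiag` is the square minus some of its corners,
which is star-shaped about the centre. -/
theorem exists_log_of_ne {e f : E(G)} (hef : e ≠ f) :
    ∃ g : ℝ × ℝ → ℂ, ContinuousOn g (D.offDiag e f) ∧
      ∀ p ∈ D.offDiag e f, exp (g p) = D.arc f p.2 - D.arc e p.1 := by
  have hstar : StarConvex ℝ ((1 / 2, 1 / 2) : ℝ × ℝ) (D.offDiag e f) := by
    rintro ⟨s, t⟩ ⟨hs, ht, hst⟩ a b ha hb hab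
    rcases ha.eq_or_lt with rfl | ha
    · obtain rfl : b = 1 := by linarith
      simpa using ⟨hs, ht, hst⟩
    simp only [mem_Icc] at hs ht
    have key : ∀ u : ℝ, 0 ≤ u ∧ u ≤ 1 → 0 < a * (1 / 2) + b * u ∧ a * (1 / 2) + b * u < 1 := by
      intro u hu
      constructor <;> nlinarith
    have hs' := key s hs
    have ht' := key t ht
    refine ⟨⟨hs'.1.le, hs'.2.le⟩, ⟨ht'.1.le, ht'.2.le⟩, fun h ↦ ?_⟩
    exact hef (D.arc_injective e f _ hs' _ ht' h).1
  refine hstar.exists_continuousOn_exp_eq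
    ((continuousOn_arc_sub_arc e f).mono fun p hp ↦ ⟨hp.1, hp.2.1⟩) fun p hp ↦ ?_
  exact sub_ne_zero.2 hp.2.2.symm

/-- Off the diagonal the square falls into two triangles. The logarithm is constructed on the one
with `s < t` and carried to the other by reflection; the difference changes sign there, hence the
added πi. -/
theorem exists_log_self {e : E(G)} (he : D.tail e ≠ D.head e) :
    ∃ g : ℝ × ℝ → ℂ, ContinuousOn g (D.offDiag e e) ∧
      (∀ p ∈ D.offDiag e e, exp (g p) = D.arc e p.2 - D.arc e p.1) ∧
      ∀ s t : ℝ, t < s → g (s, t) = g (t, s) + Real.pi * I := by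
  let T : Set (ℝ × ℝ) := {p | p.1 ∈ Icc (0 : ℝ) 1 ∧ p.2 ∈ Icc (0 : ℝ) 1 ∧ p.1 < p.2}
  have hstar : StarConvex ℝ ((0, 1) : ℝ × ℝ) T := by
    rintro ⟨s, t⟩ ⟨hs, ht, hst⟩ a b ha hb hab
    simp only [mem_Icc] at hs ht hst
    simp only [T, mem_Icc, Set.mem_ofPred_eq, Prod.smul_mk, Prod.mk_add_mk, smul_eq_mul]
    refine ⟨⟨by nlinarith, by nlinarith⟩, ⟨by nlinarith, by nlinarith⟩, ?_⟩
    rcases hb.eq_or_lt with rfl | hb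
    · linarith
    · nlinarith
  obtain ⟨g, hg, hexp⟩ := hstar.exists_continuousOn_exp_eq
    ((continuousOn_arc_sub_arc (D := D) e e).mono fun p hp ↦ ⟨hp.1, hp.2.1⟩) fun p hp h ↦
      hp.2.2.ne ((D.arc_injOn he hp.2.1 hp.1 (sub_eq_zero.1 h)).symm)
  have hcases : ∀ p ∈ D.offDiag e e, p.1 < p.2 ∨ p.2 < p.1 := fun p hp ↦
    lt_or_gt_of_ne fun h ↦ hp.2.2 (by rw [h])
  refine ⟨fun p ↦ if p.1 < p.2 then g p else g p.swap + Real.pi * I, fun p hp ↦ ?_, fun p hp ↦ ?_,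
    fun s t hst ↦ by simp [hst, hst.not_gt]⟩
  · rcases hcases p hp with h | h
    · have hopen : {q : ℝ × ℝ | q.1 < q.2} ∈ 𝓝 p :=
        (isOpen_lt continuous_fst continuous_snd).mem_nhds h
      rw [← continuousWithinAt_inter hopen]
      have hsub : D.offDiag e e ∩ {q : ℝ × ℝ | q.1 < q.2} ⊆ T := fun q hq ↦
        ⟨hq.1.1, hq.1.2.1, hq.2⟩
      refine ((hg p ⟨hp.1, hp.2.1, h⟩).mono hsub).congr (fun q hq ↦ ?_) ?_
      · exact if_pos hq.2
      · exact if_pos h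
    · have hopen : {q : ℝ × ℝ | q.2 < q.1} ∈ 𝓝 p :=
        (isOpen_lt continuous_snd continuous_fst).mem_nhds h
      rw [← continuousWithinAt_inter hopen]
      have hmaps : MapsTo Prod.swap (D.offDiag e e ∩ {q : ℝ × ℝ | q.2 < q.1}) T := fun q hq ↦
        ⟨hq.1.2.1, hq.1.1, hq.2⟩
      have hc : ContinuousWithinAt (fun q ↦ g q.swap + Real.pi * I)
          (D.offDiag e e ∩ {q : ℝ × ℝ | q.2 < q.1}) p :=
        ((hg.comp continuous_swap.continuousOn hmaps) p ⟨hp, h⟩).add continuousWithinAt_const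
      refine hc.congr (fun q hq ↦ ?_) ?_
      · exact if_neg (not_lt.2 (le_of_lt hq.2))
      · exact if_neg (not_lt.2 h.le)
  · rcases hcases p hp with h | h
    · simp only [h, if_true]
      exact hexp p ⟨hp.1, hp.2.1, h⟩
    · simp only [not_lt.2 h.le, if_false]
      rw [exp_add, hexp p.swap ⟨hp.2.1, hp.1, h⟩, exp_pi_mul_I]
      simp

theorem nonempty_arcLog (hl : ∀ e, D.tail e ≠ D.head e) : Nonempty D.ArcLog := by
  classical
  choose g hg hexp using fun e f (h : e ≠ f) ↦ exists_log_of_ne (D := D) h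
  choose k hk hkexp hkswap using fun e ↦ exists_log_self (D := D) (hl e)
  refine ⟨fun e f ↦ if h : e = f then k e else g e f h, fun e f ↦ ?_, fun e f ↦ ?_, fun e ↦ ?_⟩
  · by_cases h : e = f
    · subst h; simpa using hk e
    · simpa [h] using hg e f h
  · by_cases h : e = f
    · subst h; simpa using hkexp e
    · simpa [h] using hexp e f h
  · simpa using hkswap e

/-! ### Darts, and the comparison signs of square roots. -/

variable (D) in
/-- The opposite end of a dart. -/
def tip (d : G.PlaneDart) : V(G) := D.base (d.1, !d.2)

/-- The parameter on the arc of an edge of the point with a given parameter on one of its darts. -/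
def dartParam (d : G.PlaneDart) (t : ℝ) : ℝ := if d.2 then 1 - t else t

theorem dartArc_eq (d : G.PlaneDart) (t : ℝ) : D.dartArc d t = D.arc d.1 (dartParam d t) := by
  unfold dartArc dartParam; split_ifs <;> rfl

theorem dartParam_mem {d : G.PlaneDart} {t : ℝ} (ht : t ∈ Icc (0 : ℝ) 1) :
    dartParam d t ∈ Icc (0 : ℝ) 1 := by
  unfold dartParam; split_ifs
  · exact ⟨by linarith [ht.2], by linarith [ht.1]⟩
  · exact ht

theorem continuous_dartParam (d : G.PlaneDart) : Continuous (dartParam d) := by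
  unfold dartParam; split_ifs <;> fun_prop

theorem dartArc_zero (d : G.PlaneDart) : D.dartArc d 0 = D.point (D.base d) := by
  unfold dartArc base; split_ifs <;> simp [D.arc_zero, D.arc_one]

theorem dartArc_one (d : G.PlaneDart) : D.dartArc d 1 = D.point (D.tip d) := by
  obtain ⟨e, _ | _⟩ := d <;> simp [dartArc, tip, base, D.arc_zero, D.arc_one]

theorem base_ne_tip (hl : ∀ e, D.tail e ≠ D.head e) (d : G.PlaneDart) : D.base d ≠ D.tip d := by
  obtain ⟨e, _ | _⟩ := d <;> simp [tip, base, hl e, (hl e).symm]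

theorem continuousOn_dartArc (d : G.PlaneDart) : ContinuousOn (D.dartArc d) (Icc 0 1) := by
  have := (D.arc_continuousOn d.1).comp (continuous_dartParam d).continuousOn
    fun t ht ↦ dartParam_mem ht
  exact this.congr fun t _ ↦ dartArc_eq d t

theorem dartArc_ne_dartArc {x y : G.PlaneDart} (hxy : x.1 ≠ y.1) {s t : ℝ}
    (hs : s ∈ Icc (0 : ℝ) 1) (ht : t ∈ Icc (0 : ℝ) 1) (hy : ∀ v, D.dartArc y t ≠ D.point v) :
    D.dartArc x s ≠ D.dartArc y t := by
  intro h
  rw [dartArc_eq, dartArc_eq] at h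
  rcases D.arc_eq_arc (dartParam_mem hs) (dartParam_mem ht) h with h' | h'
  · exact hxy h'.1
  · obtain ⟨v, hv⟩ := D.arc_ends_eq_point y.1 h'.2
    exact hy v ((dartArc_eq y t).trans hv)

namespace ArcLog

variable (L : D.ArcLog)

/-- The logarithm of `dartArc y t - dartArc x s` at `(s, t)`. -/
def dartLog (x y : G.PlaneDart) (s t : ℝ) : ℂ := L.log x.1 y.1 (dartParam x s, dartParam y t)

theorem exp_dartLog {x y : G.PlaneDart} {s t : ℝ} (hs : s ∈ Icc (0 : ℝ) 1)
    (ht : t ∈ Icc (0 : ℝ) 1) (h : D.dartArc x s ≠ D.dartArc y t) :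
    exp (L.dartLog x y s t) = D.dartArc y t - D.dartArc x s := by
  rw [dartArc_eq, dartArc_eq] at h ⊢
  exact L.exp_log _ _ _ ⟨dartParam_mem hs, dartParam_mem ht, h⟩

theorem continuousOn_dartLog_left {x y : G.PlaneDart} {S : Set ℝ} (hS : S ⊆ Icc 0 1) {t : ℝ}
    (ht : t ∈ Icc (0 : ℝ) 1) (h : ∀ s ∈ S, D.dartArc x s ≠ D.dartArc y t) :
    ContinuousOn (fun s ↦ L.dartLog x y s t) S := by
  refine (L.continuousOn x.1 y.1).comp (f := fun s ↦ (dartParam x s, dartParam y t))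
    (((continuous_dartParam x).prodMk continuous_const).continuousOn) fun s hs ↦ ?_
  refine ⟨dartParam_mem (hS hs), dartParam_mem ht, ?_⟩
  have := h s hs
  rwa [dartArc_eq, dartArc_eq] at this

theorem continuousOn_dartLog_right {x y : G.PlaneDart} {S : Set ℝ} (hS : S ⊆ Icc 0 1) {s : ℝ}
    (hs : s ∈ Icc (0 : ℝ) 1) (h : ∀ t ∈ S, D.dartArc x s ≠ D.dartArc y t) :
    ContinuousOn (fun t ↦ L.dartLog x y s t) S := by
  refine (L.continuousOn x.1 y.1).comp (f := fun t ↦ (dartParam x s, dartParam y t))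
    ((continuous_const.prodMk (continuous_dartParam y)).continuousOn) fun t ht ↦ ?_
  refine ⟨dartParam_mem hs, dartParam_mem (hS ht), ?_⟩
  have := h t ht
  rwa [dartArc_eq, dartArc_eq] at this

/-- Swapping the parameters adds or subtracts a half turn, according to the direction of the
dart. -/
theorem dartLog_swap (x : G.PlaneDart) {s : ℝ} (hs : 0 < s) :
    L.dartLog x x s 0 = L.dartLog x x 0 s + (if x.2 then -1 else 1) * (Real.pi * I) := by
  unfold dartLog dartParam
  split_ifs
  · rw [L.log_swap x.1 (1 - 0) (1 - s) (by linarith)]; ring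
  · rw [L.log_swap x.1 s 0 hs]; ring

/-- The sign that compares the square roots of the differences with the node at which two darts
`x` and `x'` are based, along an edge `f`. -/
noncomputable def leftSign (x x' : G.PlaneDart) (f : E(G)) : ℂ :=
  exp ((L.log x.1 f (dartParam x 0, 1 / 2) - L.log x'.1 f (dartParam x' 0, 1 / 2)) / 2)

/-- The sign that compares the square roots of the differences with the node at which two darts
`y` and `y'` are based, along an edge `e`. -/
noncomputable def rightSign (e : E(G)) (y y' : G.PlaneDart) : ℂ :=
  exp ((L.log e y.1 (1 / 2, dartParam y 0) - L.log e y'.1 (1 / 2, dartParam y' 0)) / 2)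

theorem half_mem : (1 / 2 : ℝ) ∈ Ioo (0 : ℝ) 1 := by constructor <;> norm_num

theorem half_mem' : (1 / 2 : ℝ) ∈ Icc (0 : ℝ) 1 := Ioo_subset_Icc_self half_mem

theorem arc_dartParam_zero (x : G.PlaneDart) :
    D.arc x.1 (dartParam x 0) = D.point (D.base x) := by
  rw [← dartArc_eq, dartArc_zero]

theorem zero_mem : (0 : ℝ) ∈ Icc (0 : ℝ) 1 := ⟨le_rfl, zero_le_one⟩

/-- The parameters of the points of an edge other than a given node form an interval. -/
theorem isPreconnected_ne (D : G.PlaneEmbedding) (f : E(G)) (v : V(G)) :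
    IsPreconnected {t | t ∈ Icc (0 : ℝ) 1 ∧ D.arc f t ≠ D.point v} := by
  apply OrdConnected.isPreconnected
  refine ⟨fun s hs t ht u hu ↦ ?_⟩
  have hu' : u ∈ Icc (0 : ℝ) 1 := ⟨hs.1.1.trans hu.1, hu.2.trans ht.1.2⟩
  -- Interior points of an arc are never nodes, and an endpoint lying between `s` and `t` equals one
  -- of them.
  rcases eq_ends_or_mem_Ioo hu' with (rfl | rfl) | h
  · exact (le_antisymm hu.1 hs.1.1 : s = 0) ▸ hs
  · exact (le_antisymm ht.1.2 hu.2 : t = 1) ▸ ht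
  · exact ⟨hu', D.arc_ne_point f u h v⟩

/-- Both logarithms have the same exponential, since `x` and `x'` share a base. Half their
difference thus has a constant exponential on the interval of admissible parameters, and the
reference parameter 1/2 may be moved to any other, including one at a node. -/
theorem leftSign_eq {x x' : G.PlaneDart} (hx : D.base x = D.base x') {z : G.PlaneDart} {t : ℝ}
    (ht : t ∈ Icc (0 : ℝ) 1) (hz : D.dartArc z t ≠ D.point (D.base x)) :
    L.leftSign x x' z.1 = exp ((L.dartLog x z 0 t - L.dartLog x' z 0 t) / 2) := by
  have aux : ∀ y : G.PlaneDart, D.base y = D.base x → ∀ t : ℝ,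
      t ∈ {t | t ∈ Icc (0 : ℝ) 1 ∧ D.arc z.1 t ≠ D.point (D.base x)} →
      (dartParam y 0, t) ∈ D.offDiag y.1 z.1 := fun y hy t ht ↦
    ⟨dartParam_mem zero_mem, ht.1, by rw [arc_dartParam_zero, hy]; exact ht.2.symm⟩
  refine (isPreconnected_ne D z.1 (D.base x)).exp_half_sub_eq
    (g := fun t ↦ L.log x.1 z.1 (dartParam x 0, t)) (h := fun t ↦ L.log x'.1 z.1 (dartParam x' 0, t))
    ((L.continuousOn _ _).comp (by fun_prop) (aux x rfl))
    ((L.continuousOn _ _).comp (by fun_prop) (aux x' hx.symm)) (fun t ht ↦ ?_)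
    ⟨half_mem', D.arc_ne_point _ _ half_mem _⟩ ⟨dartParam_mem ht, ?_⟩
  · simp only [L.exp_log _ _ _ (aux x rfl t ht), L.exp_log _ _ _ (aux x' hx.symm t ht),
      arc_dartParam_zero, hx]
  · rwa [← dartArc_eq]

theorem rightSign_eq {y y' : G.PlaneDart} (hy : D.base y = D.base y') {z : G.PlaneDart} {s : ℝ}
    (hs : s ∈ Icc (0 : ℝ) 1) (hz : D.dartArc z s ≠ D.point (D.base y)) :
    L.rightSign z.1 y y' = exp ((L.dartLog z y s 0 - L.dartLog z y' s 0) / 2) := by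
  have aux : ∀ x : G.PlaneDart, D.base x = D.base y → ∀ s : ℝ,
      s ∈ {s | s ∈ Icc (0 : ℝ) 1 ∧ D.arc z.1 s ≠ D.point (D.base y)} →
      (s, dartParam x 0) ∈ D.offDiag z.1 x.1 := fun x hx s hs ↦
    ⟨hs.1, dartParam_mem zero_mem, by rw [arc_dartParam_zero, hx]; exact hs.2⟩
  refine (isPreconnected_ne D z.1 (D.base y)).exp_half_sub_eq
    (g := fun s ↦ L.log z.1 y.1 (s, dartParam y 0)) (h := fun s ↦ L.log z.1 y'.1 (s, dartParam y' 0))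
    ((L.continuousOn _ _).comp (by fun_prop) (aux y rfl))
    ((L.continuousOn _ _).comp (by fun_prop) (aux y' hy.symm)) (fun s hs ↦ ?_)
    ⟨half_mem', D.arc_ne_point _ _ half_mem _⟩ ⟨dartParam_mem hs, ?_⟩
  · simp only [L.exp_log _ _ _ (aux y rfl s hs), L.exp_log _ _ _ (aux y' hy.symm s hs),
      arc_dartParam_zero, hy]
  · rwa [← dartArc_eq]

theorem leftSign_sq {x x' : G.PlaneDart} (hx : D.base x = D.base x') (f : E(G)) :
    L.leftSign x x' f ^ 2 = 1 := by
  apply exp_half_sub_sq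
  have aux : ∀ y : G.PlaneDart, (dartParam y 0, 1 / 2) ∈ D.offDiag y.1 f := fun y ↦
    ⟨dartParam_mem zero_mem, half_mem', by
      rw [arc_dartParam_zero]; exact (D.arc_ne_point f _ half_mem _).symm⟩
  rw [L.exp_log _ _ _ (aux x), L.exp_log _ _ _ (aux x'), arc_dartParam_zero, arc_dartParam_zero, hx]

theorem rightSign_sq {y y' : G.PlaneDart} (hy : D.base y = D.base y') (e : E(G)) :
    L.rightSign e y y' ^ 2 = 1 := by
  apply exp_half_sub_sq
  have aux : ∀ x : G.PlaneDart, (1 / 2, dartParam x 0) ∈ D.offDiag e x.1 := fun x ↦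
    ⟨half_mem', dartParam_mem zero_mem, by
      rw [arc_dartParam_zero]; exact D.arc_ne_point e _ half_mem _⟩
  rw [L.exp_log _ _ _ (aux y), L.exp_log _ _ _ (aux y'), arc_dartParam_zero, arc_dartParam_zero, hy]

end ArcLog

end Graph.PlaneEmbedding

/-! ### The cyclic order at a node in terms of signs. -/

namespace Graph.PlaneEmbedding

open Complex Set

variable {α β : Type*} {G : Graph α β} {D : G.PlaneEmbedding}

theorem re_one_sub_div_pos {z w : ℂ} (hw : w ≠ 0) (hzw : ‖z‖ ≤ ‖w‖) (hne : z ≠ w) :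
    0 < (1 - z / w).re := by
  have hq : ‖z / w‖ ≤ 1 := by
    rw [norm_div]; exact div_le_one_of_le₀ hzw (norm_nonneg _)
  have hq1 : z / w ≠ 1 := fun h ↦ hne ((div_eq_one_iff_eq hw).1 h)
  rw [sub_re, one_re, sub_pos]
  refine lt_of_le_of_ne ((re_le_norm _).trans hq) fun h ↦ hq1 ?_
  have hsq : (z / w).re * (z / w).re + (z / w).im * (z / w).im ≤ 1 := by
    rw [← normSq_apply, normSq_eq_norm_sq]
    nlinarith [norm_nonneg (z / w)]
  have him : (z / w).im = 0 := by
    rw [h] at hsq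
    nlinarith [mul_self_nonneg (z / w).im]
  exact Complex.ext h him

/-- `t` is a parameter at which a dart reaches the circle of radius `r` around its base for the
first time. -/
structure IsExit (D : G.PlaneEmbedding) (d : G.PlaneDart) (r t : ℝ) : Prop where
  mem_Ioo : t ∈ Ioo (0 : ℝ) 1
  norm_eq : ‖D.dartArc d t - D.point (D.base d)‖ = r
  norm_le : ∀ s ∈ Icc 0 t, ‖D.dartArc d s - D.point (D.base d)‖ ≤ r

theorem dartParam_mem_Ioo {d : G.PlaneDart} {t : ℝ} (ht : t ∈ Ioo (0 : ℝ) 1) :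
    dartParam d t ∈ Ioo (0 : ℝ) 1 := by
  unfold dartParam; split_ifs
  · exact ⟨by linarith [ht.2], by linarith [ht.1]⟩
  · exact ht

namespace IsExit

variable {x y : G.PlaneDart} {r s t : ℝ}

theorem mem_Icc (h : D.IsExit x r t) : t ∈ Icc (0 : ℝ) 1 := Ioo_subset_Icc_self h.mem_Ioo

theorem ne_point (h : D.IsExit x r t) (v : V(G)) : D.dartArc x t ≠ D.point v := by
  rw [dartArc_eq]; exact D.arc_ne_point _ _ (dartParam_mem_Ioo h.mem_Ioo) v

theorem ne_of_mem (hy : D.IsExit y r t) (hxy : x.1 ≠ y.1) (hs : s ∈ Icc (0 : ℝ) 1) :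
    D.dartArc x s ≠ D.dartArc y t := dartArc_ne_dartArc hxy hs hy.mem_Icc hy.ne_point

theorem norm_sub_base (hb : D.base x = D.base y) (hy : D.IsExit y r t) :
    ‖D.dartArc y t - D.point (D.base x)‖ = r := by rw [hb]; exact hy.norm_eq

/-- Up to its exit, `x` stays within the closed disc on whose boundary the exit point of `y` lies.
The quotient of the differences therefore stays in the right half plane, and its continuous
logarithm starting at 0 is the principal one. -/
theorem dartLog_sub_left (L : D.ArcLog) (hb : D.base x = D.base y) (hxy : x.1 ≠ y.1)
    (hx : D.IsExit x r s) (hy : D.IsExit y r t) :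
    L.dartLog x y s t - L.dartLog x y 0 t =
      log (1 - (D.dartArc x s - D.point (D.base x)) / (D.dartArc y t - D.point (D.base x))) := by
  set p := D.point (D.base x) with hp
  have hyp : D.dartArc y t - p ≠ 0 := sub_ne_zero.2 (hy.ne_point _)
  have hsub : Icc 0 s ⊆ Icc (0 : ℝ) 1 := Icc_subset_Icc le_rfl hx.mem_Icc.2
  have hexp : ∀ u ∈ Icc 0 s, exp (L.dartLog x y u t - L.dartLog x y 0 t) =
      1 - (D.dartArc x u - p) / (D.dartArc y t - p) := fun u hu ↦ by
    rw [exp_sub, L.exp_dartLog (hsub hu) hy.mem_Icc (hy.ne_of_mem hxy (hsub hu)),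
      L.exp_dartLog ArcLog.zero_mem hy.mem_Icc (hy.ne_of_mem hxy ArcLog.zero_mem), dartArc_zero,
      ← hp]
    field_simp
    ring
  have hs : s ∈ Icc 0 s := ⟨hx.mem_Icc.1, le_rfl⟩
  rw [← hexp s hs]
  refine eq_log_exp_of_re_exp_pos (g := fun u ↦ L.dartLog x y u t - L.dartLog x y 0 t)
    hx.mem_Icc.1 ?_ (by simp) fun u hu ↦ ?_
  · exact (L.continuousOn_dartLog_left hsub hy.mem_Icc
      fun u hu ↦ hy.ne_of_mem hxy (hsub hu)).sub continuousOn_const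
  · rw [hexp u hu]
    refine re_one_sub_div_pos hyp ?_ fun h ↦ hy.ne_of_mem hxy (hsub hu) (sub_left_inj.1 h)
    exact (hx.norm_le u hu).trans_eq (norm_sub_base hb hy).symm

theorem dartLog_sub_right (L : D.ArcLog) (hb : D.base x = D.base y) (hxy : x.1 ≠ y.1)
    (hx : D.IsExit x r s) (hy : D.IsExit y r t) :
    L.dartLog x y s t - L.dartLog x y s 0 =
      log (1 - (D.dartArc y t - D.point (D.base x)) / (D.dartArc x s - D.point (D.base x))) := by
  set p := D.point (D.base x) with hp
  have hxp : D.dartArc x s - p ≠ 0 := sub_ne_zero.2 (hx.ne_point _)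
  have hsub : Icc 0 t ⊆ Icc (0 : ℝ) 1 := Icc_subset_Icc le_rfl hy.mem_Icc.2
  have hexp : ∀ u ∈ Icc 0 t, exp (L.dartLog x y s u - L.dartLog x y s 0) =
      1 - (D.dartArc y u - p) / (D.dartArc x s - p) := fun u hu ↦ by
    rw [exp_sub, L.exp_dartLog hx.mem_Icc (hsub hu) (hx.ne_of_mem hxy.symm (hsub hu)).symm,
      L.exp_dartLog hx.mem_Icc ArcLog.zero_mem (hx.ne_of_mem hxy.symm ArcLog.zero_mem).symm,
      dartArc_zero, ← hb, ← hp]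
    rw [← neg_sub (D.dartArc x s) p]
    field_simp
    ring
  have ht : t ∈ Icc 0 t := ⟨hy.mem_Icc.1, le_rfl⟩
  rw [← hexp t ht]
  refine eq_log_exp_of_re_exp_pos (g := fun u ↦ L.dartLog x y s u - L.dartLog x y s 0)
    hy.mem_Icc.1 ?_ (by simp) fun u hu ↦ ?_
  · exact (L.continuousOn_dartLog_right hsub hx.mem_Icc
      fun u hu ↦ (hx.ne_of_mem hxy.symm (hsub hu)).symm).sub continuousOn_const
  · rw [hexp u hu]
    refine re_one_sub_div_pos hxp ?_ fun h ↦ hx.ne_of_mem hxy.symm (hsub hu) (sub_left_inj.1 h)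
    rw [hp, hx.norm_eq, hb]
    exact hy.norm_le u hu

theorem re_pos (hb : D.base x = D.base y) (hxy : x.1 ≠ y.1)
    (hx : D.IsExit x r s) (hy : D.IsExit y r t) :
    0 < (1 - (D.dartArc y t - D.point (D.base x)) / (D.dartArc x s - D.point (D.base x))).re :=
  re_one_sub_div_pos (sub_ne_zero.2 (hx.ne_point _))
    (by rw [norm_sub_base hb hy, hx.norm_eq])
    fun h ↦ hx.ne_of_mem hxy.symm hy.mem_Icc (sub_left_inj.1 h)

/-- The direction of `1 - u`, where `u` is the quotient of the exit points of two darts, in terms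
of the logarithms at the node. -/
theorem norm_mul_exp_half_dartLog (L : D.ArcLog) (hb : D.base x = D.base y) (hxy : x.1 ≠ y.1)
    (hx : D.IsExit x r s) (hy : D.IsExit y r t) :
    let u := (D.dartArc y t - D.point (D.base x)) / (D.dartArc x s - D.point (D.base x))
    ‖1 - u‖ * exp ((L.dartLog x y 0 t - L.dartLog x y s 0) / 2) = 1 - u := by
  intro u
  have h1 := dartLog_sub_left L hb hxy hx hy
  have h2 := dartLog_sub_right L hb hxy hx hy
  have hr : r ≠ 0 := by
    rw [← hx.norm_eq]; exact norm_ne_zero_iff.2 (sub_ne_zero.2 (hx.ne_point _))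
  have hu : ‖u‖ = 1 := by
    rw [norm_div, norm_sub_base hb hy, hx.norm_eq, div_self hr]
  have := norm_mul_exp_half_log_sub_log hu (re_pos hb hxy hx hy)
  rw [show u⁻¹ = _ from inv_div _ _, ← h1, ← h2] at this
  rw [← this]
  congr 2
  congr 2
  ring

end IsExit

/-- `f₁`, `f₂`, `f₃` are the unit directions of `1 - C / A`, `1 - B / A`, `1 - B / C`. Multiplying
the orientation number `w` by `1 - B / C` gives `-I * ε` times a positive real, so the right half
plane condition on `1 - B / C` fixes the sign of the imaginary part of `w`. -/
theorem orientation_of_directions {A B C f₁ f₂ f₃ ε : ℂ} {r : ℝ} (hr : 0 < r)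
    (hA : ‖A‖ = r) (h1 : ‖1 - C / A‖ * f₁ = 1 - C / A) (h2 : ‖1 - B / A‖ * f₂ = 1 - B / A)
    (h3 : ‖1 - B / C‖ * f₃ = 1 - B / C) (h1' : 0 < (1 - C / A).re) (h2' : 0 < (1 - B / A).re)
    (h3' : 0 < (1 - B / C).re) (hε : f₁ * f₃ * I = ε * f₂) (hε' : ε = 1 ∨ ε = -1) :
    (ε = 1 ∧ ((starRingEnd ℂ) (B - A) * (C - A)).im < 0) ∨
      (ε = -1 ∧ 0 < ((starRingEnd ℂ) (B - A) * (C - A)).im) := by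
  have hpos : ∀ z : ℂ, 0 < z.re → 0 < ‖z‖ := fun z hz ↦ norm_pos_iff.2 fun h ↦ by simp [h] at hz
  have hA0 : A ≠ 0 := norm_ne_zero_iff.1 (hA ▸ hr.ne')
  have n2 : ‖f₂‖ = 1 := by
    have := congrArg norm h2
    rw [norm_mul, norm_real, norm_norm] at this
    exact mul_left_cancel₀ (hpos _ h2').ne' (this.trans (mul_one _).symm)
  have hf2 : f₂ * (starRingEnd ℂ) f₂ = 1 := by
    rw [mul_conj, normSq_eq_norm_sq, n2]; simp
  set Z := 1 - B / C with hZ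
  set w := (starRingEnd ℂ) (B - A) * (C - A) with hw
  let ρ : ℝ := r ^ 2 * ‖1 - B / A‖ * ‖1 - C / A‖ * ‖Z‖
  have hρ : 0 < ρ := by
    have := hpos _ h1'; have := hpos _ h2'; have := hpos _ h3'
    positivity
  have hwZ : w * Z = -I * ε * ρ := by
    have hAA : A * (starRingEnd ℂ) A = (r : ℂ) ^ 2 := by
      rw [mul_conj, normSq_eq_norm_sq, hA]; simp
    have e1 : C - A = -A * (1 - C / A) := by field_simp; ring
    have e2 : (starRingEnd ℂ) (B - A) =
        -(starRingEnd ℂ) A * (‖1 - B / A‖ * (starRingEnd ℂ) f₂) := by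
      have : B - A = -A * (‖1 - B / A‖ * f₂) := by rw [h2]; field_simp; ring
      rw [this]
      simp only [map_mul, map_neg, conj_ofReal]
    rw [hw, e1, e2, ← h1]
    conv_lhs => rw [← h3]
    simp only [ρ]
    push_cast
    have hI : f₁ * f₃ = -I * ε * f₂ := by
      linear_combination (-I) * hε + f₁ * f₃ * I_mul_I
    linear_combination (‖1 - B / A‖ * ‖1 - C / A‖ * ‖Z‖ : ℂ) *
      ((starRingEnd ℂ f₂) * f₁ * f₃ * hAA + (r : ℂ) ^ 2 * starRingEnd ℂ f₂ * hI
        + (r : ℂ) ^ 2 * (-I) * ε * hf2)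
  -- Multiplication by the conjugate of `Z` isolates `w`.
  have key : w.im * normSq Z = (-I * ε * ρ * (starRingEnd ℂ) Z).im := by
    rw [← hwZ, mul_assoc, mul_conj, im_mul_ofReal]
  have hN : 0 < normSq Z := normSq_pos.2 fun h ↦ by rw [h] at h3'; simp at h3'
  rcases hε' with rfl | rfl
  · refine .inl ⟨rfl, ?_⟩
    have : w.im * normSq Z = -(ρ * Z.re) := by rw [key]; simp
    have h' := mul_pos hρ h3'
    by_contra! hge
    have := mul_nonneg hge hN.le
    linarith
  · refine .inr ⟨rfl, ?_⟩
    have : w.im * normSq Z = ρ * Z.re := by rw [key]; simp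
    have h' := mul_pos hρ h3'
    by_contra! hle
    have := mul_nonpos_of_nonpos_of_nonneg hle hN.le
    linarith

/-- The product of the four signs at a node with darts `a`, `b`, `c`. -/
noncomputable def ArcLog.nodeSign (L : D.ArcLog) (a b c : G.PlaneDart) : ℂ :=
  L.leftSign a c b.1 * L.leftSign a c c.1 * (L.rightSign a.1 b c * L.rightSign c.1 b c)

theorem ArcLog.nodeSign_sq (L : D.ArcLog) {a b c : G.PlaneDart} (hab : D.base a = D.base b)
    (hac : D.base a = D.base c) : L.nodeSign a b c ^ 2 = 1 := by
  unfold nodeSign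
  simp only [mul_pow, L.leftSign_sq hac, L.rightSign_sq (hab.symm.trans hac), mul_one]

/-- The direction of a dart as a sign: `1` if it starts at the tail of its edge. -/
def dartSign (d : G.PlaneDart) : ℂ := if d.2 then -1 else 1

/-- The orientation of the exit points of three darts at a node is determined by the node sign, and
so does not depend on the radius. -/
theorem orientation_exit (L : D.ArcLog) {a b c : G.PlaneDart} (hab : D.base a = D.base b)
    (hac : D.base a = D.base c) (nab : a.1 ≠ b.1) (nac : a.1 ≠ c.1) (nbc : b.1 ≠ c.1)
    {r s t u : ℝ} (ha : D.IsExit a r s) (hb : D.IsExit b r t) (hc : D.IsExit c r u) :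
    let w := (starRingEnd ℂ) (D.dartArc b t - D.dartArc a s) * (D.dartArc c u - D.dartArc a s)
    (dartSign c * L.nodeSign a b c = 1 ∧ w.im < 0) ∨
      (dartSign c * L.nodeSign a b c = -1 ∧ 0 < w.im) := by
  intro w
  have hcb : D.base c = D.base b := hac.symm.trans hab
  have hr : 0 < r := by
    rw [← ha.norm_eq]; exact norm_pos_iff.2 (sub_ne_zero.2 (ha.ne_point _))
  have h1 := IsExit.norm_mul_exp_half_dartLog L hac nac ha hc
  have h2 := IsExit.norm_mul_exp_half_dartLog L hab nab ha hb
  have h3 := IsExit.norm_mul_exp_half_dartLog L hcb nbc.symm hc hb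
  have h1' := IsExit.re_pos hac nac ha hc
  have h2' := IsExit.re_pos hab nab ha hb
  have h3' := IsExit.re_pos hcb nbc.symm hc hb
  rw [← hac] at h3 h3'
  have hw : w = (starRingEnd ℂ) ((D.dartArc b t - D.point (D.base a)) -
      (D.dartArc a s - D.point (D.base a))) * ((D.dartArc c u - D.point (D.base a)) -
      (D.dartArc a s - D.point (D.base a))) := by
    simp only [w, sub_sub_sub_cancel_right]
  rw [hw]
  have hη : dartSign c * dartSign c = 1 := by unfold dartSign; split_ifs <;> norm_num
  refine orientation_of_directions hr ha.norm_eq h1 h2 h3 h1' h2' h3' ?_ ?_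
  · have e1 := L.leftSign_eq hac hc.mem_Icc (hc.ne_point _)
    have e2 := L.rightSign_eq (hab.symm.trans hac) ha.mem_Icc (ha.ne_point _)
    have e3 := L.leftSign_eq hac hb.mem_Icc (hb.ne_point _)
    have e4 := L.rightSign_eq (hab.symm.trans hac) hc.mem_Icc (hc.ne_point _)
    have q3 := L.leftSign_sq hac b.1
    have q4 := L.rightSign_sq (hab.symm.trans hac) c.1
    have hI : exp ((L.dartLog c c u 0 - L.dartLog c c 0 u) / 2) = dartSign c * I := by
      rw [L.dartLog_swap c hc.mem_Ioo.1]
      unfold dartSign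
      split_ifs
      · rw [show (L.dartLog c c 0 u + -1 * (Real.pi * I) - L.dartLog c c 0 u) / 2 =
          -(Real.pi / 2 * I) by ring, exp_neg, exp_pi_div_two_mul_I, inv_I]; ring
      · rw [show (L.dartLog c c 0 u + 1 * (Real.pi * I) - L.dartLog c c 0 u) / 2 =
          Real.pi / 2 * I by ring, exp_pi_div_two_mul_I, one_mul]
    -- The half-logarithms telescope once each sign is evaluated at an exit point. The logarithm of
    -- `c` against itself occurs at both `(0, u)` and `(u, 0)`, which leaves the half turn `hI`.
    have hprod : L.leftSign a c c.1 * L.rightSign a.1 b c *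
        exp ((L.dartLog a b 0 t - L.dartLog a b s 0) / 2) =
        L.leftSign a c b.1 * L.rightSign c.1 b c *
        (exp ((L.dartLog a c 0 u - L.dartLog a c s 0) / 2) *
          exp ((L.dartLog c b 0 t - L.dartLog c b u 0) / 2)) *
        exp ((L.dartLog c c u 0 - L.dartLog c c 0 u) / 2) := by
      rw [e1, e2, e3, e4]
      simp only [← exp_add]
      congr 1
      ring
    rw [hI] at hprod
    unfold ArcLog.nodeSign
    linear_combination (-dartSign c * L.leftSign a c b.1 * L.rightSign c.1 b c) * hprod -
      dartSign c ^ 2 * I * (exp ((L.dartLog a c 0 u - L.dartLog a c s 0) / 2) *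
        exp ((L.dartLog c b 0 t - L.dartLog c b u 0) / 2)) *
          (L.leftSign a c b.1 ^ 2 * q4 + q3) -
      I * (exp ((L.dartLog a c 0 u - L.dartLog a c s 0) / 2) *
        exp ((L.dartLog c b 0 t - L.dartLog c b u 0) / 2)) * hη
  · rw [← sq_eq_one_iff, mul_pow, L.nodeSign_sq hab hac, sq, hη, one_mul]

end Graph.PlaneEmbedding

/-! ### Proper colorings of cubic graphs. -/

namespace Graph

open Set

variable {α β : Type*} {G : Graph α β}

/-- In a properly 3-edge-colored cubic graph there are no loops, and different edges at a node have
different colors. -/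
theorem IsProperColoring.no_loop_and_injective [Finite E(G)] (hG : G.IsCubic)
    {c : E(G) → EdgeColor} (hc : G.IsProperColoring c) {v : α} (hv : v ∈ V(G)) :
    (∀ e, ¬ G.IsLoopAt e v) ∧
      ∀ e f : E(G), G.Inc e v → G.Inc f v → c e = c f → e = f := by
  choose e he hce using hc v hv
  have hNfin : {e | G.IsNonloopAt e v}.Finite :=
    (Set.toFinite E(G)).subset fun e he ↦ he.edge_mem
  have hLfin : {e | G.IsLoopAt e v}.Finite :=
    (Set.toFinite E(G)).subset fun e he ↦ he.edge_mem
  have hinj : Function.Injective fun k ↦ (e k : β) := fun k l h ↦ by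
    rw [← hce k, ← hce l, Subtype.ext h]
  have hcard : (range fun k ↦ (e k : β)).ncard = 3 := by
    rw [← image_univ, ncard_image_of_injective _ hinj, ncard_univ, Nat.card_eq_fintype_card]
    rfl
  have hsub : (range fun k ↦ (e k : β)) ⊆
      {e | G.IsNonloopAt e v} ∪ {e | G.IsLoopAt e v} := by
    rintro _ ⟨k, rfl⟩
    exact (he k).isLoopAt_or_isNonloopAt.symm
  have h1 := (ncard_le_ncard hsub (hNfin.union hLfin)).trans (ncard_union_le _ _)
  have h2 := hG v hv
  -- Three distinct edges at `v` give nonloops + loops ≥ 3, while nonloops + 2 · loops = 3.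
  have hL0 : {e | G.IsLoopAt e v}.ncard = 0 := by omega
  have hL : {e | G.IsLoopAt e v} = ∅ := (ncard_eq_zero hLfin).1 hL0
  have hnl : ∀ e, ¬ G.IsLoopAt e v := fun e he ↦ by
    have : e ∈ {e | G.IsLoopAt e v} := he
    simp [hL] at this
  rw [hL, union_empty] at hsub
  have heq := eq_of_subset_of_ncard_le hsub (by omega) hNfin
  have key : ∀ f : E(G), G.Inc f v → f = e (c f) := fun f hf ↦ by
    have : (f : β) ∈ {e | G.IsNonloopAt e v} :=
      hf.isLoopAt_or_isNonloopAt.resolve_left (hnl f)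
    rw [← heq] at this
    obtain ⟨k, hk⟩ := this
    have hk' : e k = f := Subtype.ext hk
    rw [← hk', hce]
  exact ⟨hnl, fun f g hf hg hfg ↦ by rw [key f hf, key g hg, hfg]⟩

namespace PlaneEmbedding

open Complex

variable {D : G.PlaneEmbedding}

theorem inc_base (d : G.PlaneDart) : G.Inc d.1 (D.base d) := by
  obtain ⟨e, _ | _⟩ := d
  exacts [(D.isLink e).inc_left, (D.isLink e).inc_right]

theorem exists_base_eq {e : E(G)} {v : V(G)} (h : G.Inc e v) :
    ∃ d : G.PlaneDart, D.base d = v ∧ d.1 = e := by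
  rcases h.eq_or_eq_of_isLink (D.isLink e) with h' | h'
  · exact ⟨(e, false), Subtype.ext h'.symm, rfl⟩
  · exact ⟨(e, true), Subtype.ext h'.symm, rfl⟩

/-- A choice, for every node and every color, of the unique dart of that color at the node. -/
structure DartFrame (D : G.PlaneEmbedding) (c : E(G) → EdgeColor) where
  /-- the dart of a given color at a given node -/
  dart : V(G) → EdgeColor → G.PlaneDart
  base_dart : ∀ v k, D.base (dart v k) = v
  color_dart : ∀ v k, c (dart v k).1 = k
  eq_dart : ∀ d, d = dart (D.base d) (c d.1)

theorem tail_ne_head [Finite E(G)] (hG : G.IsCubic) {c : E(G) → EdgeColor}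
    (hc : G.IsProperColoring c) (e : E(G)) : D.tail e ≠ D.head e := fun h ↦
  (hc.no_loop_and_injective hG (D.tail e).2).1 e (by
    have := D.isLink e
    rwa [← h] at this)

theorem nonempty_dartFrame [Finite E(G)] (hG : G.IsCubic) {c : E(G) → EdgeColor}
    (hc : G.IsProperColoring c) : Nonempty (D.DartFrame c) := by
  have hex : ∀ (v : V(G)) k, ∃ d : G.PlaneDart, D.base d = v ∧ c d.1 = k := fun v k ↦ by
    obtain ⟨e, he, hk⟩ := hc v v.2 k
    obtain ⟨d, hd, rfl⟩ := exists_base_eq (D := D) he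
    exact ⟨d, hd, hk⟩
  choose δ hb hcol using hex
  refine ⟨δ, hb, hcol, fun d ↦ ?_⟩
  have h1 : d.1 = (δ (D.base d) (c d.1)).1 := by
    refine (hc.no_loop_and_injective hG (D.base d).2).2 _ _ (inc_base d) ?_ (hcol _ _).symm
    have := inc_base (D := D) (δ (D.base d) (c d.1))
    rwa [hb] at this
  refine Prod.ext h1 ?_
  -- Two different darts of one edge with the same base would make the edge a loop.
  by_contra h2
  have h3 : δ (D.base d) (c d.1) = (d.1, !d.2) := by
    refine Prod.ext h1.symm ?_
    simp only
    revert h2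
    cases d.2 <;> cases (δ (D.base d) (c d.1)).2 <;> simp
  have h4 := hb (D.base d) (c d.1)
  rw [h3] at h4
  exact base_ne_tip (tail_ne_head hG hc) d h4.symm

/-! ### Cancellation of signs over all nodes. -/

namespace DartFrame

variable {c : E(G) → EdgeColor} (F : D.DartFrame c)

/-- The other end of the edge of color `k` at `v`. -/
def mate (k : EdgeColor) (v : V(G)) : V(G) := D.tip (F.dart v k)

theorem dart_mate (k : EdgeColor) (v : V(G)) :
    F.dart (F.mate k v) k = ((F.dart v k).1, !(F.dart v k).2) := by
  have := F.eq_dart ((F.dart v k).1, !(F.dart v k).2)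
  simp only [F.color_dart] at this
  exact this.symm

theorem mate_mate (k : EdgeColor) (v : V(G)) : F.mate k (F.mate k v) = v := by
  rw [mate, dart_mate, tip]
  simpa using F.base_dart v k

theorem mate_ne (hl : ∀ e, D.tail e ≠ D.head e) (k : EdgeColor) (v : V(G)) : F.mate k v ≠ v := by
  have := base_ne_tip hl (F.dart v k)
  rw [F.base_dart] at this
  exact this.symm

theorem edge_ne {v : V(G)} {k l : EdgeColor} (h : k ≠ l) : (F.dart v k).1 ≠ (F.dart v l).1 :=
  fun h' ↦ h (by rw [← F.color_dart v k, ← F.color_dart v l, h'])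

/-- A sign that depends only on the edge of color `k` cancels in pairs over all nodes but one. -/
theorem prod_erase [Fintype V(G)] [DecidableEq V(G)] (hl : ∀ e, D.tail e ≠ D.head e)
    (k : EdgeColor) (v : V(G)) {f : E(G) → ℂ} (hf : ∀ e, f e ^ 2 = 1) :
    ∏ w ∈ Finset.univ.erase v, f (F.dart w k).1 = f (F.dart v k).1 := by
  have hmem : F.mate k v ∈ Finset.univ.erase v := by simp [F.mate_ne hl k v]
  rw [← Finset.mul_prod_erase _ _ hmem, F.dart_mate]
  -- With `v` and its mate removed, `mate` pairs off the remaining nodes without fixed points.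
  refine (congrArg _ ?_).trans (mul_one _)
  refine Finset.prod_involution (fun w _ ↦ F.mate k w) (fun w _ ↦ ?_) (fun w _ _ ↦ F.mate_ne hl k w)
    (fun w hw ↦ ?_) fun w _ ↦ F.mate_mate k w
  · rw [F.dart_mate, ← sq, hf]
  · simp only [Finset.mem_erase, Finset.mem_univ, and_true] at hw ⊢
    refine ⟨fun h ↦ hw.2 ?_, fun h ↦ hw.1 ?_⟩
    · rw [← F.mate_mate k w, h, F.mate_mate]
    · rw [← F.mate_mate k w, h]

/-- The node sign at `v` for the colors red, blue, purple. -/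
noncomputable def sign (L : D.ArcLog) (v : V(G)) : ℂ :=
  L.nodeSign (F.dart v .r) (F.dart v .b) (F.dart v .p)

/-- The four half-differences add up to the full difference of two logarithms of `point w - point
v`, whose exponential is 1. -/
theorem prod_pair_eq_one (L : D.ArcLog) {v w : V(G)} (hvw : v ≠ w) :
    L.leftSign (F.dart v .r) (F.dart v .p) (F.dart w .b).1 *
      L.leftSign (F.dart v .r) (F.dart v .p) (F.dart w .p).1 *
      (L.rightSign (F.dart v .r).1 (F.dart w .b) (F.dart w .p) *
      L.rightSign (F.dart v .p).1 (F.dart w .b) (F.dart w .p)) = 1 := by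
  have hne : ∀ {k l}, D.dartArc (F.dart w k) 0 ≠ D.point (D.base (F.dart v l)) := fun {k l} ↦ by
    rw [dartArc_zero, F.base_dart, F.base_dart]
    exact D.point_injective.ne hvw.symm
  have hne' : ∀ {k l}, D.dartArc (F.dart v k) 0 ≠ D.point (D.base (F.dart w l)) := fun {k l} ↦ by
    rw [dartArc_zero, F.base_dart, F.base_dart]
    exact D.point_injective.ne hvw
  have hbv : D.base (F.dart v .r) = D.base (F.dart v .p) := by simp only [F.base_dart]
  have hbw : D.base (F.dart w .b) = D.base (F.dart w .p) := by simp only [F.base_dart]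
  rw [L.leftSign_eq hbv ArcLog.zero_mem hne, L.leftSign_eq hbv ArcLog.zero_mem hne,
    L.rightSign_eq hbw ArcLog.zero_mem hne', L.rightSign_eq hbw ArcLog.zero_mem hne']
  have hexp : ∀ k l, exp (L.dartLog (F.dart v k) (F.dart w l) 0 0) = D.point w - D.point v :=
    fun k l ↦ by
    rw [L.exp_dartLog ArcLog.zero_mem ArcLog.zero_mem, dartArc_zero, dartArc_zero, F.base_dart,
      F.base_dart]
    rw [dartArc_zero, dartArc_zero, F.base_dart, F.base_dart]
    exact D.point_injective.ne hvw
  simp only [← exp_add]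
  have h1 := hexp .r .b
  rw [← hexp .p .p] at h1
  refine (congrArg exp (?_ : _ = L.dartLog (F.dart v .r) (F.dart w .b) 0 0 -
    L.dartLog (F.dart v .p) (F.dart w .p) 0 0)).trans
      (by rw [exp_sub, h1, div_self (exp_ne_zero _)])
  ring

/-- The product of all node signs is `1`. -/
theorem prod_sign [Fintype V(G)] (hl : ∀ e, D.tail e ≠ D.head e) (L : D.ArcLog) :
    ∏ v, F.sign L v = 1 := by
  classical
  have hbv : ∀ v k l, D.base (F.dart v k) = D.base (F.dart v l) := by simp [F.base_dart]
  have hcomm : ∀ f : V(G) → V(G) → ℂ, ∏ v, ∏ w ∈ Finset.univ.erase v, f v w =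
      ∏ w, ∏ v ∈ Finset.univ.erase w, f v w := fun f ↦
    Finset.prod_comm' fun v w ↦ by simp [eq_comm]
  calc ∏ v, F.sign L v
      = (∏ v, (∏ w ∈ Finset.univ.erase v,
            L.leftSign (F.dart v .r) (F.dart v .p) (F.dart w .b).1) *
          ∏ w ∈ Finset.univ.erase v,
            L.leftSign (F.dart v .r) (F.dart v .p) (F.dart w .p).1) *
        ∏ w, (∏ v ∈ Finset.univ.erase w,
            L.rightSign (F.dart v .r).1 (F.dart w .b) (F.dart w .p)) *
          ∏ v ∈ Finset.univ.erase w,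
            L.rightSign (F.dart v .p).1 (F.dart w .b) (F.dart w .p) := by
        rw [← Finset.prod_mul_distrib]
        refine Finset.prod_congr rfl fun v _ ↦ ?_
        -- Each product over the other nodes collapses to its factor at the node itself, which gives
        -- the four factors of `nodeSign`.
        rw [F.prod_erase hl .b v fun e ↦ L.leftSign_sq (hbv v _ _) e,
          F.prod_erase hl .p v fun e ↦ L.leftSign_sq (hbv v _ _) e,
          F.prod_erase hl .r v (f := fun e ↦ L.rightSign e _ _)
            fun e ↦ L.rightSign_sq (hbv v _ _) e,
          F.prod_erase hl .p v (f := fun e ↦ L.rightSign e _ _)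
            fun e ↦ L.rightSign_sq (hbv v _ _) e]
        rfl
    _ = ∏ v, ∏ w ∈ Finset.univ.erase v, (1 : ℂ) := by
        have hsplit : ∀ f g : V(G) → V(G) → ℂ, ∏ w, (∏ v ∈ Finset.univ.erase w, f v w) *
            ∏ v ∈ Finset.univ.erase w, g v w = ∏ v, ∏ w ∈ Finset.univ.erase v, f v w * g v w :=
          fun f g ↦ by
            rw [hcomm]
            exact Finset.prod_congr rfl fun w _ ↦ Finset.prod_mul_distrib.symm
        rw [hsplit, ← Finset.prod_mul_distrib]
        refine Finset.prod_congr rfl fun v _ ↦ ?_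
        rw [← Finset.prod_mul_distrib, ← Finset.prod_mul_distrib]
        refine Finset.prod_congr rfl fun w hw ↦ ?_
        exact F.prod_pair_eq_one L (Finset.ne_of_mem_erase hw)
    _ = 1 := by simp

/-- The two ends of an edge of color `k` have opposite directions and contribute `I * (-I) = 1`. -/
theorem prod_I_mul_dartSign [Fintype V(G)] (hl : ∀ e, D.tail e ≠ D.head e) (k : EdgeColor) :
    ∏ v, I * dartSign (F.dart v k) = 1 := by
  refine Finset.prod_involution (fun w _ ↦ F.mate k w) (fun w _ ↦ ?_) (fun w _ _ ↦ F.mate_ne hl k w)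
    (fun w _ ↦ Finset.mem_univ _) fun w _ ↦ F.mate_mate k w
  rw [F.dart_mate]
  unfold dartSign
  cases (F.dart w k).2 <;> simp

end DartFrame

end PlaneEmbedding

end Graph

/-! ### Node values and the bracket. -/

namespace EdgeColor

open Complex

/-- The orientation of any three of the points `z r`, `z b`, `z p` is that of the triple
`(z r, z b, z p)` times the epsilon tensor. -/
theorem orientation_eq_eps_mul (z : EdgeColor → ℂ) (i j k : EdgeColor) :
    ((starRingEnd ℂ) (z j - z i) * (z k - z i)).im =
      (eps i j k : ℝ) * ((starRingEnd ℂ) (z b - z r) * (z p - z r)).im := by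
  cases i <;> cases j <;> cases k <;> simp [eps] <;> ring

theorem eq_of_eps_ne_zero {i j k : EdgeColor} (h : eps i j k ≠ 0) (l : EdgeColor) :
    l = i ∨ l = j ∨ l = k := by
  revert i j k l; decide

theorem eps_eq (i j k : EdgeColor) : eps i j k = 1 ∨ eps i j k = -1 ∨ eps i j k = 0 := by
  revert i j k; decide

end EdgeColor

namespace Graph.PlaneEmbedding

open Complex Set

variable {α β : Type*} {G : Graph α β} {D : G.PlaneEmbedding}

theorem eventually_isExit (hl : ∀ e, D.tail e ≠ D.head e) (d : G.PlaneDart) :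
    ∀ᶠ r in 𝓝[>] (0 : ℝ), D.IsExit d r
      (sInf {t ∈ Icc (0 : ℝ) 1 | dist (D.dartArc d t) (D.point (D.base d)) = r}) := by
  have hpos : 0 < dist (D.dartArc d 1) (D.point (D.base d)) := by
    rw [dist_pos, dartArc_one]
    exact D.point_injective.ne (base_ne_tip hl d).symm
  filter_upwards [Ioo_mem_nhdsGT hpos] with r hr
  obtain ⟨h0, h1, heq, hle⟩ :=
    exists_first_exit (continuousOn_dartArc d) (dartArc_zero d) hr.1 hr.2.le
  -- The exit comes before parameter 1 because `r` is less than the distance to the tip.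
  refine ⟨⟨h0, lt_of_le_of_ne h1 fun h ↦ ?_⟩, by rwa [← dist_eq_norm],
    fun s hs ↦ by rw [← dist_eq_norm]; exact hle s hs⟩
  rw [h] at heq
  exact hr.2.ne' heq

open Classical in
/-- At a node that misses a color, the tensor vanishes. -/
theorem nodeValue_eq_zero {c : E(G) → EdgeColor} {v : V(G)} {k : EdgeColor}
    (hk : ∀ e : E(G), G.Inc e v → c e ≠ k) : D.nodeValue c v = 0 := by
  unfold nodeValue
  split_ifs with h
  · have hd := h.choose_spec.2.1
    set d := h.choose
    have hne : ∀ i, k ≠ c (d i).1 := fun i ↦ by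
      have hi : d i ∈ {x | D.base x = v} := hd ▸ mem_range_self i
      have := inc_base (D := D) (d i)
      rw [show D.base (d i) = v from hi] at this
      exact (hk _ this).symm
    have : EdgeColor.eps (c (d 0).1) (c (d 1).1) (c (d 2).1) = 0 := by
      by_contra hne0
      rcases EdgeColor.eq_of_eps_ne_zero hne0 k with h' | h' | h'
      exacts [hne _ h', hne _ h', hne _ h']
    simp [EdgeColor.penroseTensor, this]
  -- Without a clockwise listing, the default value of `nodeValue` is already 0.
  · rfl

namespace DartFrame

variable {c : E(G) → EdgeColor} (F : D.DartFrame c)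

theorem sign_cases (L : D.ArcLog) (v : V(G)) :
    ∃ ε : ℤ, (ε = 1 ∨ ε = -1) ∧ dartSign (F.dart v .p) * F.sign L v = ε := by
  have hb : ∀ k l, D.base (F.dart v k) = D.base (F.dart v l) := by simp [F.base_dart]
  have h1 : (dartSign (F.dart v .p) * F.sign L v) ^ 2 = 1 := by
    rw [mul_pow, sign, L.nodeSign_sq (hb _ _) (hb _ _)]
    unfold dartSign; split_ifs <;> norm_num
  rcases sq_eq_one_iff.1 h1 with h | h
  · exact ⟨1, .inl rfl, by simp [h]⟩
  · exact ⟨-1, .inr rfl, by simp [h]⟩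

/-- On small circles around a node, the orientation of the exit points of the red, blue and purple
darts is given by the sign of the node. -/
theorem eventually_orientation (hl : ∀ e, D.tail e ≠ D.head e) (L : D.ArcLog) (v : V(G)) {ε : ℤ}
    (hε : dartSign (F.dart v .p) * F.sign L v = ε) :
    ∀ᶠ r in 𝓝[>] (0 : ℝ),
      ε * ((starRingEnd ℂ) (D.exitPoint (F.dart v .b) r - D.exitPoint (F.dart v .r) r) *
        (D.exitPoint (F.dart v .p) r - D.exitPoint (F.dart v .r) r)).im < 0 := by
  have hb : ∀ k l, D.base (F.dart v k) = D.base (F.dart v l) := by simp [F.base_dart]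
  filter_upwards [eventually_isExit hl (F.dart v .r), eventually_isExit hl (F.dart v .b),
    eventually_isExit hl (F.dart v .p)] with r h1 h2 h3
  have := orientation_exit L (hb .r .b) (hb .r .p) (F.edge_ne (by decide))
    (F.edge_ne (by decide)) (F.edge_ne (by decide)) h1 h2 h3
  simp only [sign] at hε
  rw [hε] at this
  rcases this with ⟨h, h'⟩ | ⟨h, h'⟩
  · obtain rfl : ε = 1 := by exact_mod_cast h
    rw [Int.cast_one, one_mul]
    exact h'
  · obtain rfl : ε = -1 := by exact_mod_cast h
    rw [Int.cast_neg, Int.cast_one, neg_one_mul, neg_lt_zero]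
    exact h'

theorem isClockwiseListing (hl : ∀ e, D.tail e ≠ D.head e) (L : D.ArcLog) (v : V(G))
    {i : Fin 3 → EdgeColor} (hi : Function.Bijective i)
    (hε : dartSign (F.dart v .p) * F.sign L v = EdgeColor.eps (i 0) (i 1) (i 2)) :
    D.IsClockwiseListing v fun j ↦ F.dart v (i j) := by
  refine ⟨fun j k h ↦ hi.1 ?_, ?_, ?_⟩
  · rw [← F.color_dart v (i j), ← F.color_dart v (i k)]
    exact congrArg (fun d ↦ c d.1) h
  · ext x
    constructor
    · rintro ⟨j, rfl⟩
      exact F.base_dart v (i j)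
    · intro (hx : D.base x = v)
      obtain ⟨j, hj⟩ := hi.2 (c x.1)
      exact ⟨j, by simp only [hj]; rw [← hx]; exact (F.eq_dart x).symm⟩
  · filter_upwards [F.eventually_orientation hl L v hε] with r hr
    rwa [EdgeColor.orientation_eq_eps_mul (fun k ↦ D.exitPoint (F.dart v k) r)]

open Classical in
theorem nodeValue_eq (hl : ∀ e, D.tail e ≠ D.head e) (L : D.ArcLog) (v : V(G)) :
    D.nodeValue c v = I * (dartSign (F.dart v .p) * F.sign L v) := by
  obtain ⟨ε, hε1, hε⟩ := F.sign_cases L v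
  have hex : ∃ d, D.IsClockwiseListing v d := by
    rcases hε1 with rfl | rfl
    · exact ⟨_, F.isClockwiseListing hl L v (i := ![.r, .b, .p]) (by decide) hε⟩
    · exact ⟨_, F.isClockwiseListing hl L v (i := ![.r, .p, .b]) (by decide) hε⟩
  unfold nodeValue
  rw [dif_pos hex, hε, EdgeColor.penroseTensor]
  obtain ⟨-, hrange, hcw⟩ := hex.choose_spec
  set d := hex.choose
  have hd : ∀ j, d j = F.dart v (c (d j).1) := fun j ↦ by
    have hj : d j ∈ {x | D.base x = v} := hrange ▸ mem_range_self j
    have := F.eq_dart (d j)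
    rwa [show D.base (d j) = v from hj] at this
  -- The chosen listing may differ from the one constructed above. On one common small circle both
  -- `eps` of its colors and `ε` make the same orientation number negative, so they agree.
  obtain ⟨r, hr, hr'⟩ := (hcw.and (F.eventually_orientation hl L v hε)).exists
  rw [hd 0, hd 1, hd 2,
    EdgeColor.orientation_eq_eps_mul (fun k ↦ D.exitPoint (F.dart v k) r)] at hr
  congr 2
  rcases EdgeColor.eps_eq (c (d 0).1) (c (d 1).1) (c (d 2).1) with h | h | h <;>
    rcases hε1 with rfl | rfl <;> rw [h] at hr ⊢ <;> push_cast at hr hr' <;> linarith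

end DartFrame

theorem prod_nodeValue [Fintype V(G)] [Fintype E(G)] (hG : G.IsCubic) {c : E(G) → EdgeColor}
    (hc : G.IsProperColoring c) : ∏ v, D.nodeValue c v = 1 := by
  have hl := tail_ne_head (D := D) hG hc
  obtain ⟨L⟩ := nonempty_arcLog hl
  obtain ⟨F⟩ := nonempty_dartFrame (D := D) hG hc
  simp only [F.nodeValue_eq hl L, ← mul_assoc]
  rw [Finset.prod_mul_distrib, F.prod_I_mul_dartSign hl, F.prod_sign hl, one_mul]

theorem prod_nodeValue_of_not_proper [Fintype V(G)] {c : E(G) → EdgeColor}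
    (hc : ¬ G.IsProperColoring c) : ∏ v, D.nodeValue c v = 0 := by
  unfold IsProperColoring at hc
  push Not at hc
  obtain ⟨v, hv, k, hk⟩ := hc
  exact Finset.prod_eq_zero (Finset.mem_univ ⟨v, hv⟩) (nodeValue_eq_zero hk)

end Graph.PlaneEmbedding

theorem mainTheorem2 {α β : Type*} (G : Graph α β) [Fintype V(G)] [Fintype E(G)]
    (hG : G.IsCubic) (D : G.PlaneEmbedding) :
    D.penroseBracket = (Nat.card {c : E(G) → EdgeColor // G.IsProperColoring c} : ℂ) := by
  classical
  have h : ∀ c, ∏ v, D.nodeValue c v = if G.IsProperColoring c then 1 else 0 := fun c ↦ by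
    split_ifs with hc
    exacts [Graph.PlaneEmbedding.prod_nodeValue hG hc,
      Graph.PlaneEmbedding.prod_nodeValue_of_not_proper hc]
  rw [Graph.PlaneEmbedding.penroseBracket, Finset.sum_congr rfl fun c _ ↦ h c, Finset.sum_boole,
    Nat.card_eq_fintype_card, Fintype.card_subtype]
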